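/- Let $X$ and $U$ be Banach spaces over $\mathbb K\in\{\mathbb R,\mathbb C\}$, let $A$ generate a $C_0$-semigroup $(T(t))_{t\ge0}$ on $X$, let $X_{-1}$ be the completion of $X$ with respect to the norm $\|x\|_{-1}=\|(\lambda I-A)^{-1}x\|$ for some $\lambda\in\rho(A)$, let $T_{-1}(t)\in\mathcal L(X_{-1})$ be the continuous extension of $T(t)$, and let $B\in\mathcal L(U,X_{-1})$. The mild solution of $\Sigma(A,B)$: $\dot x=Ax+Bu$, $x(0)=x_0$, is $$x(t)=T(t)x_0+\int_0^tT_{-1}(t-s)Bu(s)\,ds\in X_{-1},\qquad t\ge0.$$ A Young function is a function $\Phi(t)=\int_0^t\varphi(s)\,ds$, $t\ge0$, where $\varphi:[0,\infty)\to\mathbb R$ is right-continuous and nondecreasing, $\varphi(0)=0$, $\varphi(s)>0$ for $s>0$, and $\varphi(s)\to\infty$ as $s\to\infty$. For an interval $I$, $L_\Phi(I;U)$ is the space of (classes of) Bochner-measurable $u:I\to U$ with $\int_I\Phi(k^{-1}\|u(x)\|)\,dx<\infty$ for some $k>0$, with the Luxemburg norm $\|u\|_\Phi=\inf\{k>0:\int_I\Phi(k^{-1}\|u(x)\|)\,dx\le1\}$;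 for bounded $I$, $E_\Phi(I;U)$ is the closure of $L^\infty(I;U)$ in $L_\Phi(I;U)$. Let $\mathcal K$ be the set of continuous, strictly increasing $\mu:[0,\infty)\to[0,\infty)$ with $\mu(0)=0$, let $\mathcal K_\infty$ be the set of $\theta\in\mathcal K$ with $\theta(x)\to\infty$ as $x\to\infty$, and let $\mathcal L$ be the set of continuous, strictly decreasing $\gamma:[0,\infty)\to[0,\infty)$ with $\gamma(t)\to0$ as $t\to\infty$. $\Sigma(A,B)$ is $E_\Phi$-sISS (strongly input-to-state stable) if there are $\mu\in\mathcal K$ and $\beta:X\times[0,\infty)\to[0,\infty)$ with $\beta(x,\cdot)\in\mathcal L$ for all $x\ne0$ such that for all $t\ge0$, $x_0\in X$ and $u\in E_\Phi(0,t;U)$ the state $x(t)$ lies in $X$ and $$\|x(t)\|\le\beta(x_0,t)+\mu(\|u\|_{E_\Phi(0,t;U)}).$$ It is $E_\Phi$-siISS (strongly integral input-to-state stable) if there are $\theta\in\mathcal K_\infty$, $\mu\in\mathcal K$ and $\beta:X\times[0,\infty)\to[0,\infty)$ with $\beta(x,\cdot)\in\mathcal L$ for all $x\ne0$ such that for all $t\ge0$,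 $x_0\in X$ and $u\in E_\Phi(0,t;U)$ the integral $\int_0^t\mu(\|u(s)\|_U)\,ds$ is finite, the state $x(t)$ lies in $X$ and $$\|x(t)\|\le\beta(x_0,t)+\theta\Big(\int_0^t\mu(\|u(s)\|_U)\,ds\Big).$$ **Theorem.** Let $\Phi$ be a Young function which satisfies the $\Delta_2$-condition with $s_0=0$, that is, there is $k>0$ with $\Phi(2s)\le k\,\Phi(s)$ for all $s\ge0$. If $\Sigma(A,B)$ is $E_\Phi$-sISS, then it is $E_\Phi$-siISS. -/

import Mathlib

open Set Filter Topology MeasureTheory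
open scoped NNReal ENNReal

/-! ### Strongly continuous semigroups, generators and resolvents -/

/-- A strongly continuous (`C₀`-) semigroup of bounded operators on `X`. -/
structure C0Semigroup (𝕜 X : Type*) [RCLike 𝕜] [NormedAddCommGroup X] [NormedSpace 𝕜 X] where
  toFun : ℝ≥0 → X →L[𝕜] X
  map_zero' : toFun 0 = ContinuousLinearMap.id 𝕜 X
  map_add' : ∀ s t : ℝ≥0, toFun (s + t) = (toFun s).comp (toFun t)
  continuous' : ∀ x : X, Continuous fun t => toFun t x

namespace C0Semigroup

variable {𝕜 X : Type*} [RCLike 𝕜] [NormedAddCommGroup X] [NormedSpace 𝕜 X]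

instance : CoeFun (C0Semigroup 𝕜 X) (fun _ => ℝ≥0 → X →L[𝕜] X) := ⟨C0Semigroup.toFun⟩

/-- `A x = y`, that is, `(T(h) x - x) / h → y` as `h ↘ 0`. -/
def HasGenerator (T : C0Semigroup 𝕜 X) (x y : X) : Prop :=
  Tendsto (fun h : ℝ≥0 => ((h : ℝ) : 𝕜)⁻¹ • (T h x - x)) (𝓝[>] 0) (𝓝 y)

theorem HasGenerator.add {T : C0Semigroup 𝕜 X} {x y x' y' : X} (h : T.HasGenerator x y)
    (h' : T.HasGenerator x' y') : T.HasGenerator (x + x') (y + y') := by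
  refine (Tendsto.add h h').congr fun t => ?_
  rw [← smul_add, map_add]
  congr 1
  abel

theorem HasGenerator.smul {T : C0Semigroup 𝕜 X} {x y : X} (c : 𝕜) (h : T.HasGenerator x y) :
    T.HasGenerator (c • x) (c • y) := by
  refine (Tendsto.const_smul h c).congr fun t => ?_
  rw [map_smul, ← smul_sub, smul_comm]

theorem HasGenerator.unique {T : C0Semigroup 𝕜 X} {x y y' : X} (h : T.HasGenerator x y)
    (h' : T.HasGenerator x y') : y = y' :=
  tendsto_nhds_unique h h'

/-- The infinitesimal generator `A` of the semigroup: an unbounded operator whose domain consists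
of those `x` for which the limit of `(T(h) x - x) / h` as `h ↘ 0` exists, and `A x` is the limit. -/
noncomputable def generator (T : C0Semigroup 𝕜 X) : X →ₗ.[𝕜] X where
  domain :=
    { carrier := {x | ∃ y, T.HasGenerator x y}
      add_mem' := fun ⟨_, h⟩ ⟨_, h'⟩ => ⟨_, h.add h'⟩
      zero_mem' := ⟨0, by simp [HasGenerator]⟩
      smul_mem' := fun c _ ⟨_, h⟩ => ⟨_, h.smul c⟩ }
  toFun :=
    { toFun := fun x => Classical.choose x.2
      map_add' := fun x y => (Classical.choose_spec (x + y).2).unique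
        ((Classical.choose_spec x.2).add (Classical.choose_spec y.2))
      map_smul' := fun c x => (Classical.choose_spec (c • x).2).unique
        ((Classical.choose_spec x.2).smul c) }

theorem generator_spec (T : C0Semigroup 𝕜 X) (x : T.generator.domain) :
    T.HasGenerator x (T.generator x) :=
  Classical.choose_spec x.2

/-- `R` is the bounded inverse of `z I - A : D(A) → X`. -/
def IsResolventAt (A : X →ₗ.[𝕜] X) (z : 𝕜) (R : X →L[𝕜] X) : Prop :=
  (∀ y : X, ∃ h : R y ∈ A.domain, z • R y - A ⟨R y, h⟩ = y) ∧
    ∀ x : A.domain, R (z • (x : X) - A x) = x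

/-- The resolvent set `ρ(A)`. -/
def resolventSet (A : X →ₗ.[𝕜] X) : Set 𝕜 := {z | ∃ R : X →L[𝕜] X, IsResolventAt A z R}

/-- The resolvent `(z I - A)⁻¹` at a point `z ∈ ρ(A)`. -/
noncomputable def resolvent {A : X →ₗ.[𝕜] X} {z : 𝕜} (hz : z ∈ resolventSet A) : X →L[𝕜] X :=
  Classical.choose hz

theorem resolvent_spec {A : X →ₗ.[𝕜] X} {z : 𝕜} (hz : z ∈ resolventSet A) :
    IsResolventAt A z (resolvent hz) :=
  Classical.choose_spec hz

theorem resolvent_injective {A : X →ₗ.[𝕜] X} {z : 𝕜} (hz : z ∈ resolventSet A) :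
    Function.Injective (resolvent hz) := by
  intro x y hxy
  obtain ⟨hx, hx'⟩ := (resolvent_spec hz).1 x
  obtain ⟨hy, hy'⟩ := (resolvent_spec hz).1 y
  rw [← hx', ← hy']
  simp only [hxy]

theorem resolvent_comm (T : C0Semigroup 𝕜 X) {z : 𝕜} (hz : z ∈ resolventSet T.generator)
    (t : ℝ≥0) (x : X) : resolvent hz (T t x) = T t (resolvent hz x) := by
  obtain ⟨hx, hx'⟩ := (resolvent_spec hz).1 x
  have h1 : T.HasGenerator (T t (resolvent hz x)) (T t (T.generator ⟨resolvent hz x, hx⟩)) := by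
    refine (((T t).continuous.tendsto _).comp (T.generator_spec ⟨_, hx⟩)).congr fun h => ?_
    have h2 : T t (T h (resolvent hz x)) = T h (T t (resolvent hz x)) := by
      rw [← ContinuousLinearMap.comp_apply, ← T.map_add', add_comm, T.map_add',
        ContinuousLinearMap.comp_apply]
    simp only [Function.comp_apply, map_smul, map_sub, h2]
  have h3 := (T.generator_spec ⟨_, ⟨_, h1⟩⟩).unique h1
  have h4 := (resolvent_spec hz).2 ⟨T t (resolvent hz x), ⟨_, h1⟩⟩
  rw [h3] at h4
  change resolvent hz (z • T t (resolvent hz x) - _) = T t (resolvent hz x) at h4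
  rw [← map_smul, ← map_sub, hx'] at h4
  exact h4

/-! ### The extrapolation space `X₋₁` and the extrapolated semigroup -/

/-- The vector space `X`, to be normed by `‖x‖₋₁ = ‖(z I - A)⁻¹ x‖`. -/
def PreExtrapolation (T : C0Semigroup 𝕜 X) {z : 𝕜} (_hz : z ∈ resolventSet T.generator) : Type _ :=
  X

section Extrapolation

variable (T : C0Semigroup 𝕜 X) {z : 𝕜} (hz : z ∈ resolventSet T.generator)

instance : AddCommGroup (PreExtrapolation T hz) := inferInstanceAs (AddCommGroup X)

instance : Module 𝕜 (PreExtrapolation T hz) := inferInstanceAs (Module 𝕜 X)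

/-- The identity map from `X` to `X` with the norm `‖·‖₋₁`. -/
def toPre : X ≃ₗ[𝕜] PreExtrapolation T hz := LinearEquiv.refl 𝕜 X

/-- The resolvent as a map from `X` with the norm `‖·‖₋₁` to `X`; the former norm is defined so
that this is an isometry. -/
noncomputable def resolventPre : PreExtrapolation T hz →ₗ[𝕜] X :=
  (resolvent hz).toLinearMap ∘ₗ (toPre T hz).symm.toLinearMap

noncomputable instance : NormedAddCommGroup (PreExtrapolation T hz) :=
  NormedAddCommGroup.induced (PreExtrapolation T hz) X (resolventPre T hz)
    ((resolvent_injective hz).comp (toPre T hz).symm.injective)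

theorem norm_toPre (x : X) : ‖toPre T hz x‖ = ‖resolvent hz x‖ := rfl

noncomputable instance : NormedSpace 𝕜 (PreExtrapolation T hz) :=
  NormedSpace.induced 𝕜 (PreExtrapolation T hz) X (resolventPre T hz)

/-- The extrapolation space `X₋₁`: the completion of `X` with respect to
`‖x‖₋₁ = ‖(z I - A)⁻¹ x‖`. -/
def Extrapolation : Type _ := UniformSpace.Completion (PreExtrapolation T hz)

noncomputable instance : NormedAddCommGroup (Extrapolation T hz) :=
  inferInstanceAs (NormedAddCommGroup (UniformSpace.Completion (PreExtrapolation T hz)))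

noncomputable instance : NormedSpace 𝕜 (Extrapolation T hz) :=
  inferInstanceAs (NormedSpace 𝕜 (UniformSpace.Completion (PreExtrapolation T hz)))

instance : CompleteSpace (Extrapolation T hz) :=
  inferInstanceAs (CompleteSpace (UniformSpace.Completion (PreExtrapolation T hz)))

/-- The real structure of `X₋₁`, used for the Bochner integral. -/
noncomputable instance : NormedSpace ℝ (Extrapolation T hz) :=
  NormedSpace.restrictScalars ℝ 𝕜 (Extrapolation T hz)

/-- The isometric dense inclusion of `(X, ‖·‖₋₁)` into `X₋₁`. -/
noncomputable def preInclusion : PreExtrapolation T hz →L[𝕜] Extrapolation T hz :=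
  UniformSpace.Completion.toComplL

/-- The inclusion `X ⊆ X₋₁`. -/
noncomputable def inclusion : X →ₗ[𝕜] Extrapolation T hz :=
  (preInclusion T hz).toLinearMap ∘ₗ (toPre T hz).toLinearMap

/-- The operator `T(t)` on `X`, which is bounded with respect to `‖·‖₋₁`. -/
noncomputable def preMap (t : ℝ≥0) : PreExtrapolation T hz →L[𝕜] PreExtrapolation T hz :=
  LinearMap.mkContinuous
    ((toPre T hz).toLinearMap ∘ₗ (T t).toLinearMap ∘ₗ (toPre T hz).symm.toLinearMap) ‖T t‖
    (fun x => by
      change ‖resolvent hz (T t ((toPre T hz).symm x))‖ ≤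
        ‖T t‖ * ‖resolvent hz ((toPre T hz).symm x)‖
      rw [resolvent_comm]
      exact (T t).le_opNorm _)

/-- The operator `T₋₁(t)`: the unique continuous extension of `T(t)` to `X₋₁`. -/
noncomputable def extrapolated (t : ℝ≥0) : Extrapolation T hz →L[𝕜] Extrapolation T hz :=
  ((preInclusion T hz).comp (preMap T hz t)).extend (preInclusion T hz)

theorem extrapolated_inclusion (t : ℝ≥0) (x : X) :
    extrapolated T hz t (inclusion T hz x) = inclusion T hz (T t x) :=
  ContinuousLinearMap.extend_eq _ UniformSpace.Completion.denseRange_coe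
    (UniformSpace.Completion.isUniformInducing_coe _) (toPre T hz x)

end Extrapolation

end C0Semigroup

/-! ### Young functions and Orlicz spaces -/

/-- `Φ` is a Young function, generated by some `φ`. -/
def IsYoungFunction (Φ : ℝ≥0 → ℝ) : Prop :=
  ∃ φ : ℝ≥0 → ℝ,
    (∀ s, ContinuousWithinAt φ (Ici s) s) ∧ Monotone φ ∧ φ 0 = 0 ∧ (∀ s, 0 < s → 0 < φ s) ∧
      Tendsto φ atTop atTop ∧ ∀ t : ℝ≥0, Φ t = ∫ s in (0 : ℝ)..t, φ s.toNNReal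

/-- The `Δ₂`-condition with threshold `s₀`. -/
def SatisfiesDelta2 (Φ : ℝ≥0 → ℝ) (s₀ : ℝ≥0) : Prop :=
  ∃ k : ℝ, 0 < k ∧ ∀ s : ℝ≥0, s₀ ≤ s → Φ (2 * s) ≤ k * Φ s

section Orlicz

variable {U : Type*} [NormedAddCommGroup U]

/-- The modular `∫_I Φ(k⁻¹ ‖u(x)‖) dx ∈ [0, ∞]`. -/
noncomputable def orliczModular (Φ : ℝ≥0 → ℝ) (I : Set ℝ) (u : ℝ → U) (k : ℝ≥0) : ℝ≥0∞ :=
  ∫⁻ x in I, ENNReal.ofReal (Φ (k⁻¹ * ‖u x‖₊))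

/-- `u` represents an element of the Orlicz space `L_Φ(I; U)`. -/
def MemOrlicz (Φ : ℝ≥0 → ℝ) (I : Set ℝ) (u : ℝ → U) : Prop :=
  AEStronglyMeasurable u (volume.restrict I) ∧ ∃ k : ℝ≥0, 0 < k ∧ orliczModular Φ I u k < ∞

/-- The Luxemburg norm on `L_Φ(I; U)`. -/
noncomputable def luxemburgNorm (Φ : ℝ≥0 → ℝ) (I : Set ℝ) (u : ℝ → U) : ℝ≥0 :=
  sInf {k : ℝ≥0 | 0 < k ∧ orliczModular Φ I u k ≤ 1}

/-- `u` represents an element of `E_Φ(I; U)`, the closure of `L^∞(I; U)` in `L_Φ(I; U)`, for a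
bounded interval `I`. -/
def MemE (Φ : ℝ≥0 → ℝ) (I : Set ℝ) (u : ℝ → U) : Prop :=
  MemOrlicz Φ I u ∧
    ∀ ε : ℝ≥0, 0 < ε → ∃ v : ℝ → U, MemLp v ∞ (volume.restrict I) ∧ luxemburgNorm Φ I (u - v) < ε

end Orlicz

/-! ### Comparison functions -/

/-- The class `𝒦`. -/
def ClassK (μ : ℝ≥0 → ℝ≥0) : Prop := μ 0 = 0 ∧ Continuous μ ∧ StrictMono μ

/-- The class `𝒦_∞`. -/
def ClassKInfty (θ : ℝ≥0 → ℝ≥0) : Prop := ClassK θ ∧ Tendsto θ atTop atTop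

/-- The class `ℒ`. -/
def ClassL (γ : ℝ≥0 → ℝ≥0) : Prop := Continuous γ ∧ StrictAnti γ ∧ Tendsto γ atTop (𝓝 0)

/-! ### The system `Σ(A, B)` and its stability notions -/

namespace C0Semigroup

variable {𝕜 X U : Type*} [RCLike 𝕜] [NormedAddCommGroup X] [NormedSpace 𝕜 X]
  [NormedAddCommGroup U] [NormedSpace 𝕜 U]

/-- The state `T(t) x₀ + ∫₀ᵗ T₋₁(t - s) B u(s) ds` of the mild solution at time `t`, with the
(Bochner) integral taken in `X₋₁`, exists, lies in `X` and equals `x`. -/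
def IsMildState (T : C0Semigroup 𝕜 X) {z : 𝕜} (hz : z ∈ resolventSet T.generator)
    (B : U →L[𝕜] Extrapolation T hz) (x₀ : X) (u : ℝ → U) (t : ℝ≥0) (x : X) : Prop :=
  IntervalIntegrable (fun s : ℝ => extrapolated T hz (t - s).toNNReal (B (u s))) volume 0 t ∧
    inclusion T hz x = inclusion T hz (T t x₀) +
      ∫ s in (0 : ℝ)..t, extrapolated T hz (t - s).toNNReal (B (u s))

/-- `Σ(A, B)` is strongly input-to-state stable with respect to `E_Φ`. -/
def IsSISS (T : C0Semigroup 𝕜 X) {z : 𝕜} (hz : z ∈ resolventSet T.generator)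
    (B : U →L[𝕜] Extrapolation T hz) (Φ : ℝ≥0 → ℝ) : Prop :=
  ∃ (μ : ℝ≥0 → ℝ≥0) (β : X → ℝ≥0 → ℝ≥0),
    ClassK μ ∧ (∀ x, x ≠ 0 → ClassL (β x)) ∧
      ∀ (t : ℝ≥0) (x₀ : X) (u : ℝ → U), MemE Φ (Ioo 0 (t : ℝ)) u →
        ∃ x : X, IsMildState T hz B x₀ u t x ∧
          ‖x‖₊ ≤ β x₀ t + μ (luxemburgNorm Φ (Ioo 0 (t : ℝ)) u)

/-- `Σ(A, B)` is strongly integral input-to-state stable with respect to `E_Φ`. The integral of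
`μ(‖u(s)‖)` over `(0, t)` is required to be finite, as `θ` is defined on finite values only. -/
def IsSIISS (T : C0Semigroup 𝕜 X) {z : 𝕜} (hz : z ∈ resolventSet T.generator)
    (B : U →L[𝕜] Extrapolation T hz) (Φ : ℝ≥0 → ℝ) : Prop :=
  ∃ (θ μ : ℝ≥0 → ℝ≥0) (β : X → ℝ≥0 → ℝ≥0),
    ClassKInfty θ ∧ ClassK μ ∧ (∀ x, x ≠ 0 → ClassL (β x)) ∧
      ∀ (t : ℝ≥0) (x₀ : X) (u : ℝ → U), MemE Φ (Ioo 0 (t : ℝ)) u →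
        (∫⁻ s in Ioo 0 (t : ℝ), (μ ‖u s‖₊ : ℝ≥0∞)) < ∞ ∧
          ∃ x : X, IsMildState T hz B x₀ u t x ∧
            ‖x‖₊ ≤ β x₀ t + θ (∫⁻ s in Ioo 0 (t : ℝ), (μ ‖u s‖₊ : ℝ≥0∞)).toNNReal

end C0Semigroup

/-! The state is affine in the data: x(t) is T(t)x₀ plus a forced response linear in u. Zero input
in the sISS estimate gives ‖T(t)x₀‖ ≤ β(x₀,t). Inputs in the unit ball have a forced response
bounded uniformly in t, because β(x₀,t) ≤ β(x₀,0); by homogeneity the forced response is then at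
most M‖u‖_Φ (`IsSISS.exists_bound`).

It remains to bound the Luxemburg norm by a 𝒦_∞ function θ of the modular ∫Φ(‖u‖), so that μ = Φ
works. If Φ(2s) ≤ KΦ(s) and the modular is m ≤ 1, then shrinking the scale by 2ⁿ costs at most a
factor Kⁿ, so ‖u‖_Φ is at most of order m^α with K^α = 2. For m > 1 convexity gives ‖u‖_Φ ≤ m. Hence
θ(m) = 2m^α + m (`exists_classKInfty_orliczModular_le_one`). -/

namespace IsYoungFunction

variable {Φ : ℝ≥0 → ℝ}

theorem map_zero (hΦ : IsYoungFunction Φ) : Φ 0 = 0 := by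
  obtain ⟨φ, -, -, -, -, -, h⟩ := hΦ
  simp [h]

theorem strictMono_and_continuous (hΦ : IsYoungFunction Φ) :
    StrictMono Φ ∧ Continuous Φ := by
  obtain ⟨φ, -, hm, -, hpos, -, h⟩ := hΦ
  have hmono : Monotone fun s : ℝ => φ s.toNNReal := fun _ _ hst => hm (Real.toNNReal_mono hst)
  have hint : ∀ a b : ℝ, IntervalIntegrable (fun s : ℝ => φ s.toNNReal) volume a b :=
    fun a b => hmono.intervalIntegrable
  constructor
  · intro a b hab
    rw [h, h, ← sub_pos, intervalIntegral.integral_interval_sub_left (hint _ _) (hint _ _)]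
    refine intervalIntegral.intervalIntegral_pos_of_pos_on (hint _ _) (fun x hx => hpos _ ?_)
      (by exact_mod_cast hab)
    exact Real.toNNReal_pos.2 (a.2.trans_lt hx.1)
  · have : Φ = (fun b : ℝ => ∫ s in (0 : ℝ)..b, φ s.toNNReal) ∘ ((↑) : ℝ≥0 → ℝ) := funext h
    rw [this]
    exact (intervalIntegral.continuous_primitive hint 0).comp NNReal.continuous_coe

theorem strictMono (hΦ : IsYoungFunction Φ) : StrictMono Φ :=
  hΦ.strictMono_and_continuous.1

theorem continuous (hΦ : IsYoungFunction Φ) : Continuous Φ :=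
  hΦ.strictMono_and_continuous.2

theorem nonneg (hΦ : IsYoungFunction Φ) (s : ℝ≥0) : 0 ≤ Φ s :=
  hΦ.map_zero.symm.le.trans (hΦ.strictMono.monotone zero_le)

/-- Convexity along rays from the origin: substituting s ↦ a s in the integral leaves φ(a s) ≤ φ(s).
-/
theorem map_mul_le (hΦ : IsYoungFunction Φ) {a : ℝ≥0} (ha : a ≤ 1) (s : ℝ≥0) :
    Φ (a * s) ≤ a * Φ s := by
  obtain ⟨φ, -, hm, -, -, -, h⟩ := hΦ
  have hmono : Monotone fun s : ℝ => φ s.toNNReal := fun _ _ hst => hm (Real.toNNReal_mono hst)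
  have hmono' : Monotone fun s : ℝ => φ (a * s : ℝ).toNNReal :=
    hmono.comp fun x y hxy => mul_le_mul_of_nonneg_left hxy a.2
  have h1 := intervalIntegral.mul_integral_comp_mul_left (a := 0) (b := (s : ℝ))
    (c := (a : ℝ)) (f := fun s : ℝ => φ s.toNNReal)
  rw [h, h, NNReal.coe_mul, ← mul_zero (a : ℝ), ← h1, mul_zero]
  refine mul_le_mul_of_nonneg_left (intervalIntegral.integral_mono_on s.2
    hmono'.intervalIntegrable hmono.intervalIntegrable fun x hx => hmono ?_) a.2
  exact mul_le_of_le_one_left hx.1 (by exact_mod_cast ha)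

theorem classK (hΦ : IsYoungFunction Φ) : ClassK fun s => (Φ s).toNNReal :=
  ⟨by simp [hΦ.map_zero], continuous_real_toNNReal.comp hΦ.continuous, fun _ b hab =>
    (Real.toNNReal_lt_toNNReal_iff ((hΦ.nonneg _).trans_lt (hΦ.strictMono hab))).2
      (hΦ.strictMono hab)⟩

theorem exists_doubling (hΦ : IsYoungFunction Φ) (hΔ : SatisfiesDelta2 Φ 0) :
    ∃ K : ℝ≥0, 1 < K ∧ ∀ (n : ℕ) (s : ℝ≥0), Φ (2 ^ n * s) ≤ K ^ n * Φ s := by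
  obtain ⟨k, -, hk⟩ := hΔ
  -- The maximum with 2 forces K > 1, so that log K > 0 later.
  refine ⟨max k.toNNReal 2, lt_max_of_lt_right one_lt_two, fun n => ?_⟩
  have hk' (s : ℝ≥0) : Φ (2 * s) ≤ (max k.toNNReal 2 : ℝ≥0) * Φ s :=
    (hk s zero_le).trans (mul_le_mul_of_nonneg_right
      ((Real.le_coe_toNNReal k).trans (by exact_mod_cast le_max_left _ _)) (hΦ.nonneg s))
  induction n with
  | zero => simp
  | succ n ih =>
    intro s
    rw [pow_succ, mul_assoc, pow_succ, mul_assoc]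
    exact (ih _).trans (mul_le_mul_of_nonneg_left (hk' s) (by positivity))

end IsYoungFunction

/-! ### Modular and Luxemburg norm -/

section Orlicz

variable {Φ : ℝ≥0 → ℝ} {I : Set ℝ}

theorem orliczModular_le_const_mul {U : Type*} [NormedAddCommGroup U] {u : ℝ → U} {k l C : ℝ≥0}
    (h : ∀ s : ℝ≥0, Φ (k⁻¹ * s) ≤ C * Φ (l⁻¹ * s)) :
    orliczModular Φ I u k ≤ C * orliczModular Φ I u l := by
  unfold orliczModular
  rw [← lintegral_const_mul' _ _ ENNReal.coe_ne_top]
  refine lintegral_mono fun x => ?_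
  rw [← ENNReal.ofReal_coe_nnreal, ← ENNReal.ofReal_mul C.coe_nonneg]
  exact ENNReal.ofReal_le_ofReal (h _)

theorem luxemburgNorm_le {U : Type*} [NormedAddCommGroup U] {u : ℝ → U} {k : ℝ≥0} (hk : 0 < k)
    (h : orliczModular Φ I u k ≤ 1) : luxemburgNorm Φ I u ≤ k :=
  csInf_le (OrderBot.bddBelow _) ⟨hk, h⟩

theorem orliczModular_zero {U : Type*} [NormedAddCommGroup U] (hΦ : IsYoungFunction Φ) (k : ℝ≥0) :
    orliczModular Φ I (0 : ℝ → U) k = 0 := by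
  simp [orliczModular, hΦ.map_zero]

theorem luxemburgNorm_zero {U : Type*} [NormedAddCommGroup U] (hΦ : IsYoungFunction Φ) :
    luxemburgNorm Φ I (0 : ℝ → U) = 0 :=
  le_antisymm (le_of_forall_pos_le_add fun ε hε => by
    simpa using luxemburgNorm_le (I := I) (u := (0 : ℝ → U)) hε
      (by simp [orliczModular_zero hΦ])) zero_le

theorem memE_zero {U : Type*} [NormedAddCommGroup U] (hΦ : IsYoungFunction Φ) :
    MemE Φ I (0 : ℝ → U) :=
  ⟨⟨aestronglyMeasurable_zero, 1, one_pos, by simp [orliczModular_zero hΦ]⟩,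
    fun ε hε => ⟨0, MemLp.zero, by simpa [luxemburgNorm_zero hΦ] using hε⟩⟩

/-- Rounding k up to a power of 2 and doubling that many times moves finiteness from scale k to
scale 1; this is the finiteness of ∫μ(‖u‖) for μ = Φ. -/
theorem MemOrlicz.orliczModular_one_lt_top {U : Type*} [NormedAddCommGroup U] {u : ℝ → U}
    (hΦ : IsYoungFunction Φ) (hΔ : SatisfiesDelta2 Φ 0) (hu : MemOrlicz Φ I u) :
    orliczModular Φ I u 1 < ∞ := by
  obtain ⟨-, k, hk, hfin⟩ := hu
  obtain ⟨K, -, hK⟩ := hΦ.exists_doubling hΔ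
  obtain ⟨n, hn⟩ := pow_unbounded_of_one_lt k one_lt_two
  refine (orliczModular_le_const_mul (C := K ^ n) (l := k) fun s => ?_).trans_lt
    (ENNReal.mul_lt_top ENNReal.coe_lt_top hfin)
  refine le_trans (hΦ.strictMono.monotone ?_) ((hK n _).trans_eq (by push_cast; rfl))
  calc (1 : ℝ≥0)⁻¹ * s = k * (k⁻¹ * s) := by rw [mul_inv_cancel_left₀ hk.ne']; simp
    _ ≤ 2 ^ n * (k⁻¹ * s) := mul_le_mul_left hn.le _

/-- Under the `Δ₂`-condition, the Luxemburg norm is controlled by the modular. -/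
theorem exists_classKInfty_orliczModular_le_one (hΦ : IsYoungFunction Φ)
    (hΔ : SatisfiesDelta2 Φ 0) :
    ∃ θ : ℝ≥0 → ℝ≥0, ClassKInfty θ ∧ ∀ {U : Type*} [NormedAddCommGroup U] (I : Set ℝ) (u : ℝ → U)
      (m k : ℝ≥0), orliczModular Φ I u 1 ≤ m → θ m < k →
      ∃ l, 0 < l ∧ l ≤ k ∧ orliczModular Φ I u l ≤ 1 := by
  obtain ⟨K, hK1, hK⟩ := hΦ.exists_doubling hΔ
  have hK1' : (1 : ℝ) < K := by exact_mod_cast hK1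
  have hK0 : 0 < K := one_pos.trans hK1
  set α : ℝ := Real.log 2 / Real.log K with hα
  have hlog : 0 < Real.log K := Real.log_pos hK1'
  have hα0 : 0 < α := div_pos (Real.log_pos one_lt_two) hlog
  have hKα : K ^ α = 2 := by
    rw [← NNReal.coe_inj, NNReal.coe_rpow, Real.rpow_def_of_pos (by positivity), hα,
      mul_div_cancel₀ _ hlog.ne', Real.exp_log two_pos]
    rfl
  have hscale (n : ℕ) {U : Type _} [NormedAddCommGroup U] (I : Set ℝ) (u : ℝ → U) (m : ℝ≥0)
      (hm : orliczModular Φ I u 1 ≤ m) (hn : K ^ n * m ≤ 1) :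
      orliczModular Φ I u (2 ^ n)⁻¹ ≤ 1 := by
    refine (orliczModular_le_const_mul (C := K ^ n) (l := 1) fun s => ?_).trans
      ((mul_le_mul_right hm _).trans (by exact_mod_cast hn))
    simpa using hK n s
  refine ⟨fun m => 2 * m ^ α + m, ⟨⟨by simp [hα0.ne'], ?_, ?_⟩, ?_⟩, ?_⟩
  · exact (continuous_const.mul (NNReal.continuous_rpow_const hα0.le)).add continuous_id
  · exact ((NNReal.strictMono_rpow_of_pos hα0).const_mul two_pos).add strictMono_id
  · exact tendsto_atTop_mono (fun m => le_add_of_nonneg_left zero_le) tendsto_id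
  · intro U _ I u m k hm hk
    -- For m = 0 every scale 2⁻ⁿ is admissible; the strict inequality θ(m) < k leaves room for a
    -- positive one.
    rcases eq_or_ne m 0 with rfl | hm0
    · obtain ⟨n, hn⟩ := exists_pow_lt_of_lt_one (by simpa [hα0.ne'] using hk)
        (show (2 : ℝ≥0)⁻¹ < 1 from inv_lt_one_of_one_lt₀ one_lt_two)
      exact ⟨(2 ^ n)⁻¹, by positivity, by rw [← inv_pow]; exact hn.le,
        hscale n I u 0 hm (by simp)⟩
    rcases le_or_gt m 1 with hm1 | hm1
    -- With Kⁿ ≤ 1/m < Kⁿ⁺¹, raising the right inequality to the power α gives 2⁻ⁿ ≤ 2m^α; the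
    -- factor 2 in θ pays for rounding to an integer exponent.
    · obtain ⟨n, hn, hn'⟩ := exists_nat_pow_near ((one_le_inv₀ (pos_iff_ne_zero.2 hm0)).2 hm1) hK1
      refine ⟨(2 ^ n)⁻¹, by positivity, ?_, hscale n I u m hm ?_⟩
      · refine le_trans ?_ hk.le
        refine le_add_of_le_of_nonneg ?_ zero_le
        have h1 : (m⁻¹) ^ α ≤ 2 ^ (n + 1) := by
          refine (NNReal.rpow_le_rpow hn'.le hα0.le).trans_eq ?_
          rw [← hKα, ← NNReal.rpow_natCast, ← NNReal.rpow_natCast, ← NNReal.rpow_mul,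
            ← NNReal.rpow_mul, mul_comm]
        have h2 : 0 < m ^ α := NNReal.rpow_pos (pos_iff_ne_zero.2 hm0)
        rw [NNReal.inv_rpow, inv_le_iff_one_le_mul₀ h2, pow_succ] at h1
        rw [inv_le_iff_one_le_mul₀ (by positivity)]
        exact h1.trans_eq (by ring)
      · calc K ^ n * m ≤ m⁻¹ * m := mul_le_mul_left hn _
          _ = 1 := inv_mul_cancel₀ hm0
    · refine ⟨m, one_pos.trans hm1, le_trans (le_add_of_nonneg_left zero_le) hk.le, ?_⟩
      refine (orliczModular_le_const_mul (C := m⁻¹) (l := 1) fun s => ?_).trans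
        ((mul_le_mul_right hm _).trans ?_)
      · simpa using hΦ.map_mul_le (inv_le_one_of_one_le₀ hm1.le) s
      · rw [← ENNReal.coe_mul, inv_mul_cancel₀ hm0, ENNReal.coe_one]

variable {𝕜 U : Type*} [RCLike 𝕜] [NormedAddCommGroup U] [NormedSpace 𝕜 U]

theorem orliczModular_smul {c : 𝕜} (hc : c ≠ 0) (u : ℝ → U) (k : ℝ≥0) :
    orliczModular Φ I (c • u) (‖c‖₊ * k) = orliczModular Φ I u k := by
  have : ‖c‖₊ ≠ 0 := nnnorm_ne_zero_iff.2 hc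
  refine lintegral_congr fun x => ?_
  rw [Pi.smul_apply, nnnorm_smul, mul_inv_rev, mul_assoc, inv_mul_cancel_left₀ this]

theorem luxemburgNorm_smul {c : 𝕜} (hc : c ≠ 0) (u : ℝ → U) :
    luxemburgNorm Φ I (c • u) = ‖c‖₊ * luxemburgNorm Φ I u := by
  have hc' : 0 < ‖c‖₊ := nnnorm_pos.2 hc
  have himage : {k : ℝ≥0 | 0 < k ∧ orliczModular Φ I (c • u) k ≤ 1} =
      OrderIso.mulLeft₀ ‖c‖₊ hc' '' {k : ℝ≥0 | 0 < k ∧ orliczModular Φ I u k ≤ 1} := by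
    ext k
    constructor
    · rintro ⟨hk, h⟩
      refine ⟨‖c‖₊⁻¹ * k, ⟨by positivity, ?_⟩, by simp [hc]⟩
      rwa [← orliczModular_smul hc, mul_inv_cancel_left₀ hc'.ne']
    · rintro ⟨l, ⟨hl, h⟩, rfl⟩
      exact ⟨mul_pos hc' hl, (orliczModular_smul hc u l).trans_le h⟩
  unfold luxemburgNorm
  rw [himage]
  -- If no scale is admissible, both infima are `sInf ∅ = 0`.
  rcases {k : ℝ≥0 | 0 < k ∧ orliczModular Φ I u k ≤ 1}.eq_empty_or_nonempty with h | h
  · simp [h]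
  · exact (OrderIso.map_csInf' _ h (OrderBot.bddBelow _)).symm

theorem MemE.smul {u : ℝ → U} (hu : MemE Φ I u) {c : 𝕜} (hc : c ≠ 0) : MemE Φ I (c • u) := by
  obtain ⟨⟨hmeas, k, hk, hfin⟩, happrox⟩ := hu
  have hc' : 0 < ‖c‖₊ := nnnorm_pos.2 hc
  refine ⟨⟨hmeas.const_smul c, ‖c‖₊ * k, mul_pos hc' hk, ?_⟩, fun ε hε => ?_⟩
  · rwa [orliczModular_smul hc]
  · obtain ⟨v, hv, hlt⟩ := happrox (‖c‖₊⁻¹ * ε) (by positivity)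
    refine ⟨c • v, hv.const_smul c, ?_⟩
    rw [← smul_sub, luxemburgNorm_smul hc]
    exact (lt_inv_mul_iff₀ hc').1 hlt

end Orlicz

/-! ### Linearity of the mild solution and the uniform input bound -/

namespace C0Semigroup

variable {𝕜 X U : Type*} [RCLike 𝕜] [NormedAddCommGroup X] [NormedSpace 𝕜 X]
  [NormedAddCommGroup U] [NormedSpace 𝕜 U] {T : C0Semigroup 𝕜 X} {z : 𝕜}
  {hz : z ∈ resolventSet T.generator} {B : U →L[𝕜] Extrapolation T hz}

theorem inclusion_injective : Function.Injective (inclusion T hz) :=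
  (UniformSpace.Completion.coe_injective (PreExtrapolation T hz)).comp (toPre T hz).injective

theorem IsMildState.unique {x₀ : X} {u : ℝ → U} {t : ℝ≥0} {x y : X}
    (hx : T.IsMildState hz B x₀ u t x) (hy : T.IsMildState hz B x₀ u t y) : x = y :=
  inclusion_injective (hx.2.trans hy.2.symm)

theorem isMildState_zero_input (x₀ : X) (t : ℝ≥0) :
    T.IsMildState hz B x₀ 0 t (T t x₀) := by
  simp [IsMildState]

theorem isMildState_iff_sub {x₀ : X} {u : ℝ → U} {t : ℝ≥0} {x : X} :
    T.IsMildState hz B x₀ u t x ↔ T.IsMildState hz B 0 u t (x - T t x₀) := by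
  simp [IsMildState, sub_eq_iff_eq_add']

theorem IsMildState.smul {u : ℝ → U} {t : ℝ≥0} {x : X} (hx : T.IsMildState hz B 0 u t x) (c : ℝ) :
    T.IsMildState hz B 0 ((c : 𝕜) • u) t ((c : 𝕜) • x) := by
  -- The real structure of X₋₁ is restricted from 𝕜, so real scalars pass through the Bochner
  -- integral.
  have hsmul (y : Extrapolation T hz) : (c : 𝕜) • y = c • y := rfl
  obtain ⟨h1, h2⟩ := hx
  simp only [IsMildState, Pi.smul_apply, map_smul]
  simp only [hsmul]
  refine ⟨h1.smul c, ?_⟩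
  rw [intervalIntegral.integral_smul, h2]
  simp

variable {Φ : ℝ≥0 → ℝ}

/-- Strong input-to-state stability makes the input-to-state maps bounded uniformly in time. -/
theorem IsSISS.exists_bound (h : T.IsSISS hz B Φ) (hΦ : IsYoungFunction Φ) :
    ∃ M : ℝ≥0, 0 < M ∧ ∀ (t : ℝ≥0) (u : ℝ → U) (x : X) (k : ℝ≥0), MemE Φ (Ioo 0 (t : ℝ)) u →
      T.IsMildState hz B 0 u t x → 0 < k → orliczModular Φ (Ioo 0 (t : ℝ)) u k ≤ 1 →
      ‖x‖₊ ≤ M * k := by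
  -- Homogeneity: u/k lies in the unit ball.
  suffices H : ∃ M : ℝ≥0, 0 < M ∧ ∀ (t : ℝ≥0) (u : ℝ → U) (x : X), MemE Φ (Ioo 0 (t : ℝ)) u →
      T.IsMildState hz B 0 u t x → luxemburgNorm Φ (Ioo 0 (t : ℝ)) u ≤ 1 → ‖x‖₊ ≤ M by
    obtain ⟨M, hM, H⟩ := H
    refine ⟨M, hM, fun t u x k hu hx hk hmod => ?_⟩
    have hc : (((k⁻¹ : ℝ≥0) : ℝ) : 𝕜) ≠ 0 := by simpa using hk.ne'
    have hnorm : ‖(((k⁻¹ : ℝ≥0) : ℝ) : 𝕜)‖₊ = k⁻¹ := by ext; simp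
    have h1 := H t _ _ (hu.smul hc) (hx.smul (k⁻¹ : ℝ≥0)) (by
      rw [luxemburgNorm_smul hc, hnorm]
      exact (mul_le_mul_right (luxemburgNorm_le hk hmod) _).trans_eq (inv_mul_cancel₀ hk.ne'))
    rwa [nnnorm_smul, hnorm, inv_mul_le_iff₀ hk, mul_comm] at h1
  rcases subsingleton_or_nontrivial X with hX | hX
  · exact ⟨1, one_pos, fun t u x _ _ _ => by simp [Subsingleton.elim x 0]⟩
  -- Nothing is known about β(0,·), so the forced response is obtained as the difference of two
  -- trajectories from a nonzero x₀.
  obtain ⟨x₀, hx₀⟩ := exists_ne (0 : X)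
  obtain ⟨μ, β, hμ, hβ, hsys⟩ := h
  refine ⟨β x₀ 0 + μ 1 + β x₀ 0 + 1, by positivity, fun t u x hu hx hlux => ?_⟩
  obtain ⟨y, hy, hyb⟩ := hsys t x₀ u hu
  obtain ⟨w, hw, hwb⟩ := hsys t x₀ 0 (memE_zero hΦ)
  rw [hw.unique (isMildState_zero_input x₀ t), luxemburgNorm_zero hΦ, hμ.1, add_zero] at hwb
  have hβ0 : β x₀ t ≤ β x₀ 0 := (hβ x₀ hx₀).2.1.antitone zero_le
  rw [hx.unique (isMildState_iff_sub.1 hy)]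
  calc ‖y - T t x₀‖₊ ≤ ‖y‖₊ + ‖T t x₀‖₊ := nnnorm_sub_le _ _
    _ ≤ β x₀ 0 + μ 1 + β x₀ 0 := add_le_add
      (hyb.trans (add_le_add hβ0 (hμ.2.2.monotone hlux))) (hwb.trans hβ0)
    _ ≤ _ := le_add_of_nonneg_right zero_le

end C0Semigroup

theorem theorem3p9 {𝕜 X U : Type*} [RCLike 𝕜]
    [NormedAddCommGroup X] [NormedSpace 𝕜 X] [CompleteSpace X]
    [NormedAddCommGroup U] [NormedSpace 𝕜 U] [CompleteSpace U]
    (T : C0Semigroup 𝕜 X) {z : 𝕜} (hz : z ∈ C0Semigroup.resolventSet T.generator)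
    (B : U →L[𝕜] C0Semigroup.Extrapolation T hz)
    (Φ : ℝ≥0 → ℝ) (hΦ : IsYoungFunction Φ) (hΔ : SatisfiesDelta2 Φ 0)
    (h : T.IsSISS hz B Φ) :
    T.IsSIISS hz B Φ := by
  obtain ⟨M, hM, hbound⟩ := h.exists_bound hΦ
  obtain ⟨θ, ⟨⟨hθ0, hθc, hθm⟩, hθt⟩, hθ⟩ := exists_classKInfty_orliczModular_le_one hΦ hΔ
  obtain ⟨μ, β, hμ, hβ, hsys⟩ := h
  refine ⟨fun m => M * θ m, fun s => (Φ s).toNNReal, β,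
    ⟨⟨by simp [hθ0], continuous_const.mul hθc, hθm.const_mul hM⟩, hθt.const_mul_atTop hM⟩,
    hΦ.classK, hβ, fun t x₀ u hu => ?_⟩
  have hmod : ∫⁻ s in Ioo 0 (t : ℝ), ((Φ ‖u s‖₊).toNNReal : ℝ≥0∞) =
      orliczModular Φ (Ioo 0 (t : ℝ)) u 1 := by
    simp [orliczModular, ENNReal.ofReal]
  have hfin := hu.1.orliczModular_one_lt_top hΦ hΔ
  rw [hmod]
  refine ⟨hfin, ?_⟩
  obtain ⟨x, hx, -⟩ := hsys t x₀ u hu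
  obtain ⟨w, hw, hwb⟩ := hsys t x₀ 0 (memE_zero hΦ)
  rw [hw.unique (C0Semigroup.isMildState_zero_input x₀ t), luxemburgNorm_zero hΦ, hμ.1,
    add_zero] at hwb
  refine ⟨x, hx, ?_⟩
  have hforced : ‖x - T t x₀‖₊ ≤ M * θ (orliczModular Φ (Ioo 0 (t : ℝ)) u 1).toNNReal := by
    rw [← div_le_iff₀' hM]
    -- Admissible scales are available only below each k > θ(m), so k is let down to θ(m).
    refine le_of_forall_gt_imp_ge_of_dense fun k hk => ?_
    obtain ⟨l, hl, hlk, hl1⟩ := hθ (Ioo 0 (t : ℝ)) u _ k (ENNReal.coe_toNNReal hfin.ne).ge hk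
    rw [div_le_iff₀' hM]
    exact (hbound t u _ l hu (C0Semigroup.isMildState_iff_sub.1 hx) hl hl1).trans
      (mul_le_mul_right hlk _)
  calc ‖x‖₊ = ‖T t x₀ + (x - T t x₀)‖₊ := by rw [add_sub_cancel]
    _ ≤ ‖T t x₀‖₊ + ‖x - T t x₀‖₊ := nnnorm_add_le _ _
    _ ≤ _ := add_le_add hwb hforced
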